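/- Let $A_I,A_O,B_I,B_O$ be finite-dimensional (nonzero) quantum systems. Write ${}_XM=\frac{1^X}{d_X}\otimes\mathrm{Tr}_XM$, and let $d_O=d_{A_O}d_{B_O}$. A (bipartite) process matrix is an operator $W\ge 0$ on $A_I\otimes A_O\otimes B_I\otimes B_O$ with $\mathrm{Tr}\,W=d_O$, ${}_{B_IB_O}W={}_{A_OB_IB_O}W$, ${}_{A_IA_O}W={}_{B_OA_IA_O}W$ and $W={}_{A_O}W+{}_{B_O}W-{}_{A_OB_O}W$. It turns local channels $A:A_IA_I'\to A_OA_O'$ and $B:B_IB_I'\to B_OB_O'$ (with arbitrary finite-dimensional ancillas $A_I',A_O',B_I',B_O'$) into a channel $N=W*(A\otimes B):A_I'B_I'\to A_O'B_O'$, where $A$, $B$, $N$ are identified with their Choi matrices and $*$ is the link product, here $N=\mathrm{Tr}_{A_IA_OB_IB_O}[W^T(A\otimes B)]$. Let $W^{A\prec B}$ denote any process that cannot be used to signal from Bob to Alice (the part of $N$ seen by Alice does not depend on Bob's channel), and $W^{A\succ B}$ any process that cannot be used to signal from Alice to Bob. An $(R,n,\epsilon)$ code for entanglement transmission from Alice to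 Bob with $W$, where $n\ge 1$ and $R=\frac1n\log_2 m$ for an integer $m\ge1$, consists of channels $A_i$ (with trivial outgoing ancilla) and $B_i$ for each of the $n$ copies of $W$, giving channels $N_i=W*(A_i\otimes B_i)$ from $A_I'^{\,i}B_I'^{\,i}$ to $B_O'^{\,i}$, an encoding channel $E_A$ from an $m$-dimensional system into $\bigotimes_iA_I'^{\,i}$, a state $E_B$ of $\bigotimes_iB_I'^{\,i}$, and a decoding channel $D_B$ from $\bigotimes_iB_O'^{\,i}$ to an $m$-dimensional system, such that for every state $\sigma$ of two $m$-dimensional systems $CA$ the state $\rho=(\mathrm{id}_C\otimes M)(\sigma)$, with $M(X)=D_B\big(\bigotimes_iN_i\,(E_A(X)\otimes E_B)\big)$, satisfies $F(\sigma,\rho)\ge1-\epsilon$, where $F(\sigma,\rho)=\big(\mathrm{Tr}\sqrt{\sqrt\sigma\,\rho\sqrt\sigma}\big)^2$. A rate $R$ is achievable if there are $(R_n,n,\epsilon_n)$ codes for all $n\ge1$ with $R_n\to R$ and $\epsilon_n\to0$. The asymptotic quantum communication capacity of $W$ from Alice to Bob is the supremum of the achievable rates; the capacity from Bob to Alice is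 obtained by exchanging the roles of the parties. Then, for all processes $W^{A\prec B}$ and $W^{A\succ B}$ on the same systems, the equal mixture $W^{AB}=\frac12W^{A\prec B}+\frac12W^{A\succ B}$ has quantum communication capacity zero in both directions, from Alice to Bob and from Bob to Alice. -/

import Mathlib

open scoped MatrixOrder ComplexOrder

noncomputable section

namespace CausalComm

/-- Linear operators on the finite-dimensional Hilbert space `ℂ^a`, as matrices. -/
abbrev Op (a : Type*) := Matrix a a ℂ

/-- Density operators: positive semidefinite with trace one. -/
def IsState {a : Type*} [Fintype a] (ρ : Op a) : Prop :=
  ρ.PosSemidef ∧ ρ.trace = 1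

/-- `id_c ⊗ Φ`: apply `Φ` to every `a`-block of an operator on `ℂ^c ⊗ ℂ^a`. -/
def ampl (c : Type*) {a b : Type*} (Φ : Op a → Op b) (X : Op (c × a)) : Op (c × b) :=
  Matrix.of fun p q => Φ (Matrix.of fun s t => X (p.1, s) (q.1, t)) p.2 q.2

/-- Quantum channels: completely positive trace preserving linear maps. -/
structure IsChannel {a b : Type*} [Fintype a] [Fintype b] (Φ : Op a →ₗ[ℂ] Op b) : Prop where
  completelyPositive : ∀ (k : ℕ) (X : Op (Fin k × a)), X.PosSemidef →
    (ampl (Fin k) Φ X).PosSemidef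
  tracePreserving : ∀ X : Op a, (Φ X).trace = X.trace

/-- The Choi matrix `∑ i j, Φ(|i⟩⟨j|) ⊗ |i⟩⟨j|` on `output ⊗ input`. -/
def choi {a b : Type*} [DecidableEq a] (Φ : Op a →ₗ[ℂ] Op b) : Op (b × a) :=
  Matrix.of fun p q => Φ (Matrix.single p.2 q.2 1) p.1 q.1

/-- The map with a given Choi matrix: `X ↦ J * X = Tr_a [J^{T_a} X]`. -/
def ofChoi {a b : Type*} [Fintype a] (J : Op (b × a)) (X : Op a) : Op b :=
  Matrix.of fun p q => ∑ s, ∑ t, J (p, s) (q, t) * X s t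

/-- The Uhlmann fidelity `F(σ, ρ) = (Tr √(√σ ρ √σ))²`. -/
def fidelity {a : Type*} [Fintype a] [DecidableEq a] (σ ρ : Op a) : ℝ :=
  (CFC.sqrt (CFC.sqrt σ * ρ * CFC.sqrt σ)).trace.re ^ 2

section Processes

variable {AI AO BI BO : Type*}

/-! Operators on `A_I ⊗ A_O ⊗ B_I ⊗ B_O` have index type `(AI × AO) × (BI × BO)`. -/

/-- Exchange of the two parties. -/
def swapParties (W : Op ((AI × AO) × (BI × BO))) : Op ((BI × BO) × (AI × AO)) :=
  W.submatrix Prod.swap Prod.swap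

/-- Trace and replace on `A_I`: `(1/d) ⊗ Tr_{A_I} W`. -/
def replAI [Fintype AI] [DecidableEq AI] (W : Op ((AI × AO) × (BI × BO))) :
    Op ((AI × AO) × (BI × BO)) :=
  Matrix.of fun x y => if x.1.1 = y.1.1 then
    (Fintype.card AI : ℂ)⁻¹ * ∑ k, W ((k, x.1.2), x.2) ((k, y.1.2), y.2) else 0

/-- Trace and replace on `A_O`. -/
def replAO [Fintype AO] [DecidableEq AO] (W : Op ((AI × AO) × (BI × BO))) :
    Op ((AI × AO) × (BI × BO)) :=
  Matrix.of fun x y => if x.1.2 = y.1.2 then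
    (Fintype.card AO : ℂ)⁻¹ * ∑ k, W ((x.1.1, k), x.2) ((y.1.1, k), y.2) else 0

/-- Trace and replace on `B_I`. -/
def replBI [Fintype BI] [DecidableEq BI] (W : Op ((AI × AO) × (BI × BO))) :
    Op ((AI × AO) × (BI × BO)) :=
  Matrix.of fun x y => if x.2.1 = y.2.1 then
    (Fintype.card BI : ℂ)⁻¹ * ∑ k, W (x.1, (k, x.2.2)) (y.1, (k, y.2.2)) else 0

/-- Trace and replace on `B_O`. -/
def replBO [Fintype BO] [DecidableEq BO] (W : Op ((AI × AO) × (BI × BO))) :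
    Op ((AI × AO) × (BI × BO)) :=
  Matrix.of fun x y => if x.2.2 = y.2.2 then
    (Fintype.card BO : ℂ)⁻¹ * ∑ k, W (x.1, (x.2.1, k)) (y.1, (y.2.1, k)) else 0

variable [Fintype AI] [Fintype AO] [Fintype BI] [Fintype BO]
  [DecidableEq AI] [DecidableEq AO] [DecidableEq BI] [DecidableEq BO]

/-- Bipartite process matrices. -/
structure IsProcess (W : Op ((AI × AO) × (BI × BO))) : Prop where
  posSemidef : W.PosSemidef
  trace_eq : W.trace = (Fintype.card AO * Fintype.card BO : ℕ)
  margA : replBI (replBO W) = replAO (replBI (replBO W))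
  margB : replAI (replAO W) = replBO (replAI (replAO W))
  noLoops : W = replAO W + replBO W - replAO (replBO W)

/-- The Choi matrix `N = W * (A ⊗ B)` (link product over `A_I A_O B_I B_O`) of the map
from `A_I' B_I'` to `A_O' B_O'` that the process `W` makes out of local operations with
Choi matrices `A` (from `A_I A_I'` to `A_O A_O'`) and `B` (from `B_I B_I'` to `B_O B_O'`).
Here `Tr [W^T (A ⊗ B)]` is the sum over `s, t` of `W s t` times the entry of `A ⊗ B`. -/
def induced {AI' AO' BI' BO' : Type*} (W : Op ((AI × AO) × (BI × BO)))
    (A : Op ((AO × AO') × (AI × AI'))) (B : Op ((BO × BO') × (BI × BI'))) :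
    Op ((AO' × BO') × (AI' × BI')) :=
  Matrix.of fun p q => ∑ s, ∑ t, W s t *
    A ((s.1.2, p.1.1), (s.1.1, p.2.1)) ((t.1.2, q.1.1), (t.1.1, q.2.1)) *
    B ((s.2.2, p.1.2), (s.2.1, p.2.2)) ((t.2.2, q.1.2), (t.2.1, q.2.2))

/-- `W` cannot be used to signal from Bob to Alice: whatever channel Alice applies, with
ancillas of any dimension, the resulting channel between her ancillas does not depend on the
channel from `B_I` to `B_O` that Bob applies. (If Bob uses ancillas himself, he prepares the
incoming one, and the outgoing one is discarded in what Alice sees; what is left of his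
operation is a channel from `B_I` to `B_O`.) -/
def NoSignallingBobToAlice (W : Op ((AI × AO) × (BI × BO))) : Prop :=
  ∀ (k l : ℕ) (A : Op (AI × Fin k) →ₗ[ℂ] Op (AO × Fin l))
    (B B' : Op (BI × Unit) →ₗ[ℂ] Op (BO × Unit)),
    IsChannel A → IsChannel B → IsChannel B' →
    induced W (choi A) (choi B) = induced W (choi A) (choi B')

/-- Processes `W^{A≺B}`. -/
def IsProcessAliceFirst (W : Op ((AI × AO) × (BI × BO))) : Prop :=
  IsProcess W ∧ NoSignallingBobToAlice W

/-- Processes `W^{A≻B}`. -/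
def IsProcessBobFirst (W : Op ((AI × AO) × (BI × BO))) : Prop :=
  IsProcess W ∧ NoSignallingBobToAlice (swapParties W)

variable (AI AO BI BO) in
/-- A protocol for entanglement transmission of an `m`-dimensional system from Alice to Bob
with `n` copies of a process: a channel `A i` and a channel `B i` for each copy (where the
ancilla `A_O'` is trivial), an encoding channel `E_A` into Alice's incoming ancillas, a joint
state `E_B` of Bob's incoming ancillas and a decoding channel `D_B` from Bob's outgoing
ancillas. All ancillas have arbitrary finite dimensions. -/
structure Protocol (n m : ℕ) where
  dimA : Fin n → ℕ
  dimB : Fin n → ℕ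
  dimB' : Fin n → ℕ
  A : ∀ i, Op (AI × Fin (dimA i)) →ₗ[ℂ] Op (AO × Unit)
  B : ∀ i, Op (BI × Fin (dimB i)) →ₗ[ℂ] Op (BO × Fin (dimB' i))
  EA : Op (Fin m) →ₗ[ℂ] Op (∀ i, Fin (dimA i))
  EB : Op (∀ i, Fin (dimB i))
  DB : Op (∀ i, Fin (dimB' i)) →ₗ[ℂ] Op (Fin m)
  A_channel : ∀ i, IsChannel (A i)
  B_channel : ∀ i, IsChannel (B i)
  EA_channel : IsChannel EA
  EB_state : IsState EB
  DB_channel : IsChannel DB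

namespace Protocol

variable {n m : ℕ}

/-- The Choi matrix of `N^{⊗n} = ⨂ i, N_i` with `N_i = W * (A_i ⊗ B_i)`, from all the `A_I'`
and `B_I'` to all the `B_O'`. -/
def sharedChoi (P : Protocol AI AO BI BO n m) (W : Op ((AI × AO) × (BI × BO))) :
    Op ((∀ i, Fin (P.dimB' i)) × ((∀ i, Fin (P.dimA i)) × (∀ i, Fin (P.dimB i)))) :=
  Matrix.of fun p q => ∏ i, induced W (choi (P.A i)) (choi (P.B i))
    (((), p.1 i), (p.2.1 i, p.2.2 i)) (((), q.1 i), (q.2.1 i, q.2.2 i))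

/-- The channel `M`: adjoin Bob's state `E_B` to Alice's encoded system, apply `N^{⊗n}`,
and decode. -/
def channel (P : Protocol AI AO BI BO n m) (W : Op ((AI × AO) × (BI × BO)))
    (X : Op (Fin m)) : Op (Fin m) :=
  P.DB (ofChoi (P.sharedChoi W) (Matrix.kroneckerMap (· * ·) (P.EA X) P.EB))

end Protocol

/-- There is an `(R, n, ε)` code for entanglement transmission from Alice to Bob. -/
def HasCode (W : Op ((AI × AO) × (BI × BO))) (R : ℝ) (n : ℕ) (ε : ℝ) : Prop :=
  ∃ m : ℕ, 0 < m ∧ R = 1 / (n : ℝ) * Real.logb 2 m ∧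
    ∃ P : Protocol AI AO BI BO n m, ∀ σ : Op (Fin m × Fin m), IsState σ →
      1 - ε ≤ fidelity σ (ampl (Fin m) (P.channel W) σ)

/-- `R` is an achievable rate from Alice to Bob: there are `(R_n, n, ε_n)` codes with
`R_n → R` and `ε_n → 0`. (`R_n = R` for every `n` would force `2 ^ R` to be an integer.) -/
def Achievable (W : Op ((AI × AO) × (BI × BO))) (R : ℝ) : Prop :=
  ∃ (r ε : ℕ → ℝ), Filter.Tendsto r Filter.atTop (nhds R) ∧
    Filter.Tendsto ε Filter.atTop (nhds 0) ∧ ∀ n, 0 < n → HasCode W (r n) n (ε n)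

/-- The quantum communication capacity from Alice to Bob. -/
def capacityAliceToBob (W : Op ((AI × AO) × (BI × BO))) : EReal :=
  sSup {x : EReal | ∃ R : ℝ, Achievable W R ∧ x = (R : EReal)}

/-- The quantum communication capacity from Bob to Alice. -/
def capacityBobToAlice (W : Op ((AI × AO) × (BI × BO))) : EReal :=
  capacityAliceToBob (swapParties W)

end Processes

end CausalComm

end

noncomputable section

namespace CausalComm

/-! ### Positivity of link products -/

/-! The obstruction is no-cloning. For fixed local operations the mixture induces ½N₁ + ½N₂, where
N₂ comes from the process without signalling from Alice to Bob and is therefore the trace on Alice's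
ancilla tensored with a channel K on Bob's side (`induced_eq_ite_of_noSignalling`). Now let Bob have
a twin. Toss a fair coin: on one outcome Bob gets N₁ and the twin gets K, on the other outcome the
reverse. Each of them separately sees exactly ½N₁ + ½N₂ (`isSymExt_mixture`).

Such symmetric extensions multiply over the n copies (`IsSymExt.pi`). The fixed state E_B can be
prepared twice, and both receivers can apply D_B, so the whole coding channel M has a symmetric
extension T. If M were nearly noiseless on dimension m ≥ 2, T would nearly clone every pure state,
contradicting linearity by an explicit estimate (`false_of_symmetric_extension`). Hence a small
error forces m = 1 and rate 0 (`Protocol.not_reliable`).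

The extension must preserve the trace. This follows from the normalization of process matrices
(`IsProcess.pairing_eq`). The other direction of communication follows by exchanging the parties. -/

lemma posSemidef_collapse {p s : Type*} [Finite p] [Fintype s] {H : Op (p × s)}
    (hH : H.PosSemidef) :
    (Matrix.of (fun i j => ∑ a, ∑ b, H (i, a) (j, b)) : Op p).PosSemidef := by
  classical
  have := Fintype.ofFinite p
  -- `V` sends `e_i` to `e_i ⊗ ∑ₐ e_a`, so `Vᴴ H V` sums each block of `H`.
  let V : Matrix (p × s) p ℂ := Matrix.of fun x i => if x.1 = i then 1 else 0
  have h := hH.conjTranspose_mul_mul_same V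
  have e : V.conjTranspose * H * V = Matrix.of (fun i j => ∑ a, ∑ b, H (i, a) (j, b)) := by
    ext i j
    simp only [Matrix.of_apply, Matrix.mul_apply, Matrix.conjTranspose_apply, V,
      Fintype.sum_prod_type, apply_ite star, star_one, star_zero, ite_mul, one_mul, zero_mul,
      mul_ite, mul_one, mul_zero]
    simp only [Finset.sum_comm (s := (Finset.univ : Finset p)), Finset.sum_ite_eq',
      Finset.mem_univ, if_true]
    rw [Finset.sum_comm]
  rwa [e] at h

lemma posSemidef_mul_entries {x : Type*} {F G : Op x}
    (hF : F.PosSemidef) (hG : G.PosSemidef) :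
    (Matrix.of (fun i j => F i j * G i j) : Op x).PosSemidef :=
  hF.hadamard hG

lemma posSemidef_prod_entries {ι x : Type*} [Finite x] (s : Finset ι) {F : ι → Op x}
    (hF : ∀ i ∈ s, (F i).PosSemidef) :
    (Matrix.of (fun a b => ∏ i ∈ s, F i a b) : Op x).PosSemidef := by
  classical
  induction s using Finset.induction_on with
  | empty =>
    have h := Matrix.posSemidef_vecMulVec_self_star (fun _ : x => (1 : ℂ))
    have e : Matrix.vecMulVec (fun _ : x => (1 : ℂ)) (star fun _ : x => (1 : ℂ)) =
        Matrix.of (fun a b => ∏ i ∈ (∅ : Finset ι), F i a b) := by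
      ext a b
      simp [Matrix.vecMulVec_apply]
    rwa [e] at h
  | insert i s hi ih =>
    simp only [Finset.prod_insert hi]
    exact posSemidef_mul_entries (hF i (Finset.mem_insert_self i s))
      (ih fun j hj => hF j (Finset.mem_insert_of_mem hj))

/-- A link product is a Schur product of pulled-back factors followed by a block sum. The same
pattern gives positivity of induced channels and of operations with a state plugged in. -/
lemma posSemidef_ofChoi {a b : Type*} [Fintype a] [Finite b] {J : Op (b × a)} {X : Op a}
    (hJ : J.PosSemidef) (hX : X.PosSemidef) : (ofChoi J X).PosSemidef :=
  posSemidef_collapse (H := Matrix.of fun i j => J i j * X i.2 j.2)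
    (posSemidef_mul_entries hJ (hX.submatrix Prod.snd))

/-- `Tr_out J = 1`: the condition on a Choi matrix for its map to preserve the trace. -/
def IsTP {a b : Type*} [Fintype b] [DecidableEq a] (J : Op (b × a)) : Prop :=
  ∀ s t, ∑ p, J (p, s) (p, t) = if s = t then 1 else 0

lemma trace_ofChoi {a b : Type*} [Fintype a] [Fintype b] [DecidableEq a] {J : Op (b × a)}
    (hJ : IsTP J) (X : Op a) : (ofChoi J X).trace = X.trace := by
  simp only [Matrix.trace, Matrix.diag, ofChoi, Matrix.of_apply]
  rw [Finset.sum_comm]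
  refine Finset.sum_congr rfl fun s _ => ?_
  rw [Finset.sum_comm]
  simp only [← Finset.sum_mul, hJ s]
  simp

/-- `ofChoi` as a linear map. -/
def ofChoiₗ {a b : Type*} [Fintype a] (J : Op (b × a)) : Op a →ₗ[ℂ] Op b where
  toFun := ofChoi J
  map_add' X Y := by
    ext p q
    simp [ofChoi, mul_add, Finset.sum_add_distrib]
  map_smul' c X := by
    ext p q
    simp [ofChoi, Finset.mul_sum, mul_left_comm]

lemma choi_ofChoiₗ {a b : Type*} [Fintype a] [DecidableEq a] (J : Op (b × a)) :
    choi (ofChoiₗ J) = J := by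
  ext ⟨p, s⟩ ⟨q, t⟩
  simp only [choi, ofChoiₗ, ofChoi, Matrix.of_apply, LinearMap.coe_mk, AddHom.coe_mk,
    Matrix.single_apply]
  rw [Finset.sum_eq_single s, Finset.sum_eq_single t]
  · simp
  · intro b _ hb; simp [hb.symm]
  · simp
  · intro b _ hb; simp [hb.symm]
  · simp

lemma ofChoi_choi {a b : Type*} [Fintype a] [DecidableEq a] (Φ : Op a →ₗ[ℂ] Op b) (X : Op a) :
    ofChoi (choi Φ) X = Φ X := by
  conv_rhs => rw [Matrix.matrix_eq_sum_single X]
  ext p q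
  simp only [ofChoi, choi, Matrix.of_apply, map_sum, Matrix.sum_apply]
  refine Finset.sum_congr rfl fun s _ => Finset.sum_congr rfl fun t _ => ?_
  rw [show Matrix.single s t (X s t) = X s t • Matrix.single s t (1 : ℂ) by simp]
  rw [map_smul, Matrix.smul_apply, smul_eq_mul, mul_comm]

lemma isChannel_ofChoiₗ {a b : Type*} [Fintype a] [Fintype b] [DecidableEq a] {J : Op (b × a)}
    (hJ : J.PosSemidef) (hT : IsTP J) : IsChannel (ofChoiₗ J) where
  completelyPositive k X hX := by
    have h := posSemidef_mul_entries
      (hJ.submatrix (fun x : (Fin k × b) × a => (x.1.2, x.2)))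
      (hX.submatrix (fun x : (Fin k × b) × a => (x.1.1, x.2)))
    exact posSemidef_collapse (p := Fin k × b) (s := a) (H := Matrix.of fun x y =>
      J (x.1.2, x.2) (y.1.2, y.2) * X (x.1.1, x.2) (y.1.1, y.2)) h
  tracePreserving := trace_ofChoi hT

lemma IsChannel.posSemidef_choi {a b : Type*} [Fintype a] [Fintype b] [DecidableEq a]
    {Φ : Op a →ₗ[ℂ] Op b} (h : IsChannel Φ) : (choi Φ).PosSemidef := by
  let e := Fintype.equivFin a
  -- The unnormalized maximally entangled vector. Complete positivity is tested on references `Fin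
  -- k`, hence the enumeration `e` of `a`.
  let v : Fin (Fintype.card a) × a → ℂ := fun x => if e x.2 = x.1 then 1 else 0
  have h := (h.completelyPositive _ _ (Matrix.posSemidef_vecMulVec_self_star v)).submatrix
    (fun x : b × a => (e x.2, x.1))
  have key : ∀ s t, (Matrix.of fun i j => Matrix.vecMulVec v (star v) (e s, i) (e t, j)) =
      Matrix.single s t (1 : ℂ) := by
    intro s t
    ext i j
    simp only [Matrix.single_apply, Matrix.of_apply, Matrix.vecMulVec_apply, v, Pi.star_apply,
      EmbeddingLike.apply_eq_iff_eq]
    by_cases h1 : i = s <;> by_cases h2 : j = t <;> simp [h1, h2, eq_comm (a := s), eq_comm (a := t)]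
  have e2 : (ampl (Fin (Fintype.card a)) Φ (Matrix.vecMulVec v (star v))).submatrix
      (fun x : b × a => (e x.2, x.1)) (fun x : b × a => (e x.2, x.1)) = choi Φ := by
    ext ⟨p, s⟩ ⟨q, t⟩
    simp only [ampl, choi, Matrix.of_apply, Matrix.submatrix_apply, key]
  rwa [e2] at h

lemma IsChannel.isTP_choi {a b : Type*} [Fintype a] [Fintype b] [DecidableEq a]
    {Φ : Op a →ₗ[ℂ] Op b} (h : IsChannel Φ) : IsTP (choi Φ) := by
  intro s t
  have := h.tracePreserving (Matrix.single s t 1)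
  simp only [Matrix.trace, Matrix.diag] at this
  simp only [choi, Matrix.of_apply]
  rw [this]
  by_cases hst : s = t
  · subst hst; simp [Matrix.single_apply]
  · simp only [hst, if_false]
    refine Finset.sum_eq_zero fun i _ => ?_
    rw [Matrix.single_apply_of_ne]
    rintro ⟨rfl, rfl⟩
    exact hst rfl

lemma IsChannel.posSemidef {a b : Type*} [Fintype a] [Fintype b] [DecidableEq a]
    {Φ : Op a →ₗ[ℂ] Op b} (h : IsChannel Φ) {X : Op a} (hX : X.PosSemidef) :
    (Φ X).PosSemidef := by
  rw [← ofChoi_choi]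
  exact posSemidef_ofChoi h.posSemidef_choi hX

lemma ite_prod_eq {a b : Type*} [DecidableEq a] [DecidableEq b] (x x' : a) (y y' : b) :
    (if (x, y) = (x', y') then (1 : ℂ) else 0) =
      (if x = x' then 1 else 0) * if y = y' then 1 else 0 := by
  by_cases h : x = x' <;> by_cases h' : y = y' <;> simp [h, h']

lemma sum_comm_three {x y z M : Type*} [Fintype x] [Fintype y] [Fintype z] [AddCommMonoid M]
    (f : x → y → z → M) :
    ∑ i, ∑ j, ∑ k, f i j k = ∑ j, ∑ k, ∑ i, f i j k :=
  Finset.sum_comm.trans (Finset.sum_congr rfl fun _ _ => Finset.sum_comm)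

lemma prod_ite_eq {ι : Type*} [Fintype ι] {b : ι → Type*} [∀ i, DecidableEq (b i)]
    (s t : ∀ i, b i) [Decidable (s = t)] :
    ∏ i, (if s i = t i then (1 : ℂ) else 0) = if s = t then 1 else 0 := by
  by_cases h : s = t
  · simp [h]
  · rw [if_neg h]
    obtain ⟨i, hi⟩ := Function.ne_iff.mp h
    exact Finset.prod_eq_zero (Finset.mem_univ i) (by simp [hi])


/-! ### Fidelity with a pure state -/

lemma vecMulVec_mul_mul {a : Type*} [Fintype a] (ψ : a → ℂ) (ρ : Op a) :
    Matrix.vecMulVec ψ (star ψ) * ρ * Matrix.vecMulVec ψ (star ψ) =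
      (star ψ ⬝ᵥ (ρ.mulVec ψ)) • Matrix.vecMulVec ψ (star ψ) := by
  rw [Matrix.mul_assoc, Matrix.mul_vecMulVec, Matrix.vecMulVec_mul_vecMulVec]
  ext i j
  simp [Matrix.vecMulVec_apply]
  ring

lemma isState_pure {a : Type*} [Fintype a] {ψ : a → ℂ} (hψ : star ψ ⬝ᵥ ψ = 1) :
    IsState (Matrix.vecMulVec ψ (star ψ)) :=
  ⟨Matrix.posSemidef_vecMulVec_self_star ψ, by
    rw [Matrix.trace_vecMulVec, dotProduct_comm, hψ]⟩

/-- The projection onto ψ is its own square root, and compressing ρ by it leaves `c` times the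
projection. -/
lemma fidelity_pure {a : Type*} [Fintype a] [DecidableEq a] {ψ : a → ℂ}
    (hψ : star ψ ⬝ᵥ ψ = 1) (ρ : Op a) {c : ℝ} (hc : 0 ≤ c)
    (h : star ψ ⬝ᵥ (ρ.mulVec ψ) = c) :
    fidelity (Matrix.vecMulVec ψ (star ψ)) ρ = c := by
  have hpos : 0 ≤ Matrix.vecMulVec ψ (star ψ) :=
    (Matrix.posSemidef_vecMulVec_self_star ψ).nonneg
  have hsq : Matrix.vecMulVec ψ (star ψ) * Matrix.vecMulVec ψ (star ψ) =
      Matrix.vecMulVec ψ (star ψ) := by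
    rw [Matrix.vecMulVec_mul_vecMulVec, hψ]
    simp
  have h1 : CFC.sqrt (Matrix.vecMulVec ψ (star ψ)) = Matrix.vecMulVec ψ (star ψ) :=
    CFC.sqrt_unique hsq hpos
  have h2 : CFC.sqrt ((c : ℂ) • Matrix.vecMulVec ψ (star ψ)) =
      (Real.sqrt c : ℂ) • Matrix.vecMulVec ψ (star ψ) := by
    refine CFC.sqrt_unique ?_ ?_
    · rw [smul_mul_smul_comm, hsq, ← Complex.ofReal_mul, Real.mul_self_sqrt hc]
    · refine ((Matrix.posSemidef_vecMulVec_self_star ψ).smul ?_).nonneg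
      exact_mod_cast Real.sqrt_nonneg c
  rw [fidelity, h1, vecMulVec_mul_mul, h, h2, Matrix.trace_smul,
    (isState_pure hψ).2]
  simp [Real.sq_sqrt hc]

/-! ### Quadratic forms of positive semidefinite matrices -/

/-- The expectation value `⟨v|T|v⟩`. -/
def expect {a : Type*} [Fintype a] (T : Op a) (v : a → ℂ) : ℝ := (star v ⬝ᵥ T.mulVec v).re

section Expect

variable {a : Type*} [Fintype a]

lemma expect_nonneg {T : Op a} (hT : T.PosSemidef) (v : a → ℂ) : 0 ≤ expect T v :=
  (Complex.le_def.mp (hT.dotProduct_mulVec_nonneg v)).1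

lemma expect_ofReal {T : Op a} (hT : T.PosSemidef) (v : a → ℂ) :
    star v ⬝ᵥ T.mulVec v = (expect T v : ℂ) := by
  refine Complex.ext rfl ?_
  simpa using (Complex.le_def.mp (hT.dotProduct_mulVec_nonneg v)).2.symm

lemma expect_add (S T : Op a) (v : a → ℂ) : expect (S + T) v = expect S v + expect T v := by
  simp [expect, Matrix.add_mulVec, dotProduct_add]

lemma expect_smul (T : Op a) (r : ℝ) (v : a → ℂ) :
    expect T ((r : ℂ) • v) = r ^ 2 * expect T v := by
  simp only [expect, Matrix.mulVec_smul, star_smul, dotProduct_smul, smul_dotProduct,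
    smul_eq_mul, Complex.star_def, Complex.conj_ofReal]
  rw [← mul_assoc, ← Complex.ofReal_mul, Complex.re_ofReal_mul]
  ring

lemma expect_add_le {T : Op a} (hT : T.PosSemidef) (v w : a → ℂ) :
    expect T (v + w) ≤ 5 / 4 * expect T v + 5 * expect T w := by
  -- Young's inequality: the weights ½ and 2 bound the cross terms by ¼⟨v|T|v⟩ + 4⟨w|T|w⟩.
  have h := expect_nonneg hT (((1 / 2 : ℝ) : ℂ) • v - ((2 : ℝ) : ℂ) • w)
  have h1 : expect T (((1 / 2 : ℝ) : ℂ) • v - ((2 : ℝ) : ℂ) • w) =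
      1 / 4 * expect T v + 4 * expect T w -
        ((star v ⬝ᵥ T.mulVec w).re + (star w ⬝ᵥ T.mulVec v).re) := by
    simp only [expect, Matrix.mulVec_sub, Matrix.mulVec_smul, star_sub, star_smul,
      sub_dotProduct, dotProduct_sub, dotProduct_smul, smul_dotProduct, smul_eq_mul,
      Complex.star_def, Complex.conj_ofReal, Complex.sub_re, Complex.re_ofReal_mul]
    ring
  have h2 : expect T (v + w) = expect T v + expect T w +
        ((star v ⬝ᵥ T.mulVec w).re + (star w ⬝ᵥ T.mulVec v).re) := by
    simp only [expect, Matrix.mulVec_add, star_add, add_dotProduct, dotProduct_add,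
      Complex.add_re]
    ring
  linarith

lemma expect_eq_trace (T : Op a) (v : a → ℂ) :
    expect T v = (T * Matrix.vecMulVec v (star v)).trace.re := by
  rw [Matrix.mul_vecMulVec, Matrix.trace_vecMulVec, dotProduct_comm, expect]

/-- `Tr (TQ)` is the sum of all entries of the Schur product of `T` and `Qᵀ`. -/
lemma trace_mul_nonneg {T Q : Op a} (hT : T.PosSemidef) (hQ : Q.PosSemidef) :
    0 ≤ (T * Q).trace.re := by
  have h := posSemidef_collapse (p := Unit) (s := a)
    (posSemidef_mul_entries (hT.submatrix Prod.snd) (hQ.transpose.submatrix Prod.snd))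
  have h2 := (Complex.le_def.mp (h.diag_nonneg (i := ()))).1
  simpa [Matrix.trace, Matrix.mul_apply, Matrix.submatrix_apply] using h2

/-- Positivity of an idempotent Hermitian matrix. -/
lemma posSemidef_of_proj {P : Op a} (h1 : P.conjTranspose = P) (h2 : P * P = P) :
    P.PosSemidef := by
  have := Matrix.posSemidef_conjTranspose_mul_self P
  rwa [h1, h2] at this

lemma posSemidef_one_sub [DecidableEq a] {v : a → ℂ} (hv : star v ⬝ᵥ v = 1) :
    (1 - Matrix.vecMulVec v (star v)).PosSemidef := by
  refine posSemidef_of_proj ?_ ?_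
  · simp [Matrix.conjTranspose_vecMulVec]
  · rw [sub_mul, mul_sub, mul_sub, Matrix.vecMulVec_mul_vecMulVec, hv]
    simp

/-- The operator `1 - |u⟩⟨u| - r⁻¹|w⟩⟨w|` is a projection, so its trace against `T` is nonnegative.
-/
lemma expect_add_orthogonal_le {T : Op a} (hT : T.PosSemidef) {u w : a → ℂ}
    (hu : star u ⬝ᵥ u = 1) (huw : star u ⬝ᵥ w = 0) {r : ℝ} (hr : 0 < r)
    (hw : star w ⬝ᵥ w = r) : expect T w ≤ r * (T.trace.re - expect T u) := by
  classical
  have hwu : star w ⬝ᵥ u = 0 := by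
    have := congrArg star huw
    rwa [← Matrix.star_dotProduct_star, star_star, star_zero] at this
  have hr' : (r : ℂ) ≠ 0 := by exact_mod_cast hr.ne'
  have hP : (1 - Matrix.vecMulVec u (star u) -
      (r : ℂ)⁻¹ • Matrix.vecMulVec w (star w)).PosSemidef := by
    refine posSemidef_of_proj ?_ ?_
    · simp [Matrix.conjTranspose_vecMulVec]
    · simp only [sub_mul, mul_sub, Matrix.vecMulVec_mul_vecMulVec, hu, hw, huw, hwu,
        smul_mul_assoc, mul_smul_comm, one_mul, mul_one, one_smul, zero_smul,
        Matrix.vecMulVec_zero, smul_zero]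
      rw [Matrix.vecMulVec_smul, smul_smul (r : ℂ)⁻¹ (r : ℂ), inv_mul_cancel₀ hr']
      simp
  have h := trace_mul_nonneg hT hP
  simp only [mul_sub, mul_one, Matrix.trace_sub, Complex.sub_re, mul_smul_comm,
    Matrix.trace_smul, smul_eq_mul, ← Complex.ofReal_inv, Complex.re_ofReal_mul,
    ← expect_eq_trace] at h
  have h3 : r⁻¹ * expect T w ≤ T.trace.re - expect T u := by linarith
  calc expect T w = r * (r⁻¹ * expect T w) := by field_simp
    _ ≤ _ := mul_le_mul_of_nonneg_left h3 hr.le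

end Expect

/-! ### Partial traces and approximate cloning -/

/-- Trace out the second system. -/
def marg₁ {b : Type*} [Fintype b] {c : Type*} (T : Op (c × b)) : Op c :=
  Matrix.of fun u v => ∑ k, T (u, k) (v, k)

/-- Trace out the first system. -/
def marg₂ {c : Type*} [Fintype c] {b : Type*} (T : Op (c × b)) : Op b :=
  Matrix.of fun u v => ∑ k, T (k, u) (k, v)

lemma posSemidef_marg₁ {b c : Type*} [Fintype b] [Finite c] {T : Op (c × b)}
    (hT : T.PosSemidef) : (marg₁ T).PosSemidef := by
  classical
  have h := posSemidef_collapse (p := c) (s := b)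
    (posSemidef_mul_entries hT ((Matrix.PosSemidef.one (n := b) (R := ℂ)).submatrix Prod.snd))
  convert h using 1
  ext u v
  simp [marg₁, Matrix.one_apply]

section Clone

variable {c : Type*} [Fintype c]

/-- The product vector `v ⊗ v`. -/
def tensorSq (v : c → ℂ) : c × c → ℂ := fun x => v x.1 * v x.2

lemma star_tensorSq_dotProduct (v w : c → ℂ) :
    star (tensorSq v) ⬝ᵥ tensorSq w = (star v ⬝ᵥ w) ^ 2 := by
  simp only [dotProduct, tensorSq, Fintype.sum_prod_type, Pi.star_apply, star_mul', sq,
    Finset.sum_mul_sum]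
  exact Finset.sum_congr rfl fun i _ => Finset.sum_congr rfl fun j _ => by ring

/-- A union bound: expand the nonnegative trace of `T` against `(1 - |v⟩⟨v|) ⊗ (1 - |v⟩⟨v|)`. If
both marginals are close to `v`, the joint state is close to `v ⊗ v`. -/
lemma expect_tensorSq_ge {T : Op (c × c)} (hT : T.PosSemidef) {v : c → ℂ}
    (hv : star v ⬝ᵥ v = 1) :
    expect (marg₁ T) v + expect (marg₂ T) v - T.trace.re ≤ expect T (tensorSq v) := by
  classical
  have hP := posSemidef_one_sub hv
  have hPP := hP.kronecker hP
  have h := trace_mul_nonneg hT hPP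
  have e : (T * Matrix.kroneckerMap (fun x y => x * y) (1 - Matrix.vecMulVec v (star v))
      (1 - Matrix.vecMulVec v (star v))).trace = T.trace
        - (marg₁ T * Matrix.vecMulVec v (star v)).trace
        - (marg₂ T * Matrix.vecMulVec v (star v)).trace
        + (T * Matrix.vecMulVec (tensorSq v) (star (tensorSq v))).trace := by
    have e1 : (marg₁ T * Matrix.vecMulVec v (star v)).trace =
        (T * Matrix.kroneckerMap (· * ·) (Matrix.vecMulVec v (star v)) (1 : Op c)).trace := by
      simp only [Matrix.trace, Matrix.diag, Matrix.mul_apply, Fintype.sum_prod_type, marg₁,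
        Matrix.of_apply, Matrix.kroneckerMap_apply, Matrix.one_apply, Finset.sum_mul]
      simp only [mul_ite, mul_one, mul_zero, Finset.sum_ite_eq', Finset.mem_univ, if_true]
      refine Finset.sum_congr rfl fun i _ => ?_
      rw [Finset.sum_comm]
    have e2 : (marg₂ T * Matrix.vecMulVec v (star v)).trace =
        (T * Matrix.kroneckerMap (· * ·) (1 : Op c) (Matrix.vecMulVec v (star v))).trace := by
      simp only [Matrix.trace, Matrix.diag, Matrix.mul_apply, Fintype.sum_prod_type, marg₂,
        Matrix.of_apply, Matrix.kroneckerMap_apply, Matrix.one_apply, Finset.sum_mul]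
      simp only [ite_mul, one_mul, mul_ite, zero_mul, mul_zero, Finset.sum_ite_irrel,
        Finset.sum_const_zero, Finset.sum_ite_eq', Finset.mem_univ, if_true]
      exact (Finset.sum_congr rfl fun i _ => Finset.sum_comm).trans Finset.sum_comm
    have e3 : Matrix.vecMulVec (tensorSq v) (star (tensorSq v)) =
        Matrix.kroneckerMap (· * ·) (Matrix.vecMulVec v (star v))
          (Matrix.vecMulVec v (star v)) := by
      ext ⟨i, j⟩ ⟨k, l⟩
      simp only [Matrix.vecMulVec_apply, Matrix.kroneckerMap_apply, tensorSq, Pi.star_apply,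
        star_mul']
      ring
    have e4 : (T.trace : ℂ) =
        (T * Matrix.kroneckerMap (· * ·) (1 : Op c) (1 : Op c)).trace := by
      rw [show Matrix.kroneckerMap (· * ·) (1 : Op c) (1 : Op c) = 1 from
        Matrix.one_kronecker_one, mul_one]
    rw [e1, e2, e3, e4, ← Matrix.trace_sub, ← Matrix.trace_sub, ← Matrix.trace_add,
      ← mul_sub, ← mul_sub, ← mul_add]
    congr 2
    ext ⟨i, j⟩ ⟨k, l⟩
    simp only [Matrix.kroneckerMap_apply, Matrix.sub_apply, Matrix.add_apply]
    ring
  rw [e] at h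
  simp only [Complex.sub_re, Complex.add_re, ← expect_eq_trace] at h
  linarith

/-- If `T` is close to `|u⟩⟨u|`, the weight of `v = s u + w` is close to `s²`. -/
lemma expect_le_of_overlap {T : Op c} (hT : T.PosSemidef) (htr : T.trace = 1) {u v : c → ℂ}
    (hu : star u ⬝ᵥ u = 1) (hv : star v ⬝ᵥ v = 1) {s : ℝ} (huv : star u ⬝ᵥ v = s)
    (hs : s ^ 2 < 1) : expect T v ≤ 5 / 4 * s ^ 2 + 5 * (1 - expect T u) := by
  have hvu : star v ⬝ᵥ u = s := by
    have := congrArg star huv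
    rwa [← Matrix.star_dotProduct_star, star_star, Complex.star_def, Complex.conj_ofReal] at this
  -- Split `v` into its component along `u` and the orthogonal remainder, whose squared norm is `1 -
  -- s²`.
  have h1 := expect_add_le hT ((s : ℂ) • u) (v - (s : ℂ) • u)
  rw [add_sub_cancel, expect_smul] at h1
  have h2 : expect T (v - (s : ℂ) • u) ≤ (1 - s ^ 2) * (T.trace.re - expect T u) := by
    refine expect_add_orthogonal_le hT hu ?_ (by linarith) ?_
    · rw [dotProduct_sub, dotProduct_smul, hu, huv]; simp
    · simp only [star_sub, star_smul, dotProduct_sub, sub_dotProduct, dotProduct_smul,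
        smul_dotProduct, hu, hv, huv, hvu, smul_eq_mul, Complex.star_def, Complex.conj_ofReal]
      push_cast; ring
  have h3 : expect T u ≤ 1 := by
    have := trace_mul_nonneg (a := c) hT
      (by classical exact posSemidef_one_sub hu)
    classical
    rw [mul_sub, mul_one, Matrix.trace_sub, htr, Complex.sub_re, ← expect_eq_trace] at this
    simpa using this
  have h4 := expect_nonneg hT u
  rw [htr, Complex.one_re] at h2
  nlinarith [sq_nonneg s]

/-- The product vector `e_i ⊗ v`. -/
def localVec [DecidableEq c] (i : c) (v : c → ℂ) : c × c → ℂ :=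
  fun x => (if x.1 = i then 1 else 0) * v x.2

lemma star_localVec_dotProduct [DecidableEq c] (i : c) {v : c → ℂ} (hv : star v ⬝ᵥ v = 1) :
    star (localVec i v) ⬝ᵥ localVec i v = 1 := by
  rw [← hv]
  simp [dotProduct, localVec, Fintype.sum_prod_type, apply_ite (starRingEnd ℂ)]

/-- On product inputs the reference system is inert, so entanglement fidelity bounds already control
`M` on pure states; nothing more is needed to contradict cloning. -/
lemma ampl_localVec [DecidableEq c] (i : c) (v : c → ℂ) (M : Op c → Op c) :
    star (localVec i v) ⬝ᵥ
      (ampl c M (Matrix.vecMulVec (localVec i v) (star (localVec i v)))).mulVec (localVec i v) =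
    star v ⬝ᵥ (M (Matrix.vecMulVec v (star v))).mulVec v := by
  have h : (Matrix.of fun s t => Matrix.vecMulVec (localVec i v) (star (localVec i v))
      (i, s) (i, t)) = Matrix.vecMulVec v (star v) := by
    ext s t
    simp [Matrix.vecMulVec_apply, localVec]
  rw [← h]
  simp [dotProduct, localVec, Matrix.mulVec, Fintype.sum_prod_type, ampl,
    apply_ite (starRingEnd ℂ), Finset.sum_ite_irrel]

/-- An approximately noiseless map on a system of dimension at least two has no
symmetric extension. -/
theorem false_of_symmetric_extension {m : ℕ} (hm : 2 ≤ m) {M : Op (Fin m) → Op (Fin m)}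
    {T : Op (Fin m) → Op (Fin m × Fin m)} (hadd : ∀ X Y, T (X + Y) = T X + T Y)
    (hpos : ∀ X, X.PosSemidef → (T X).PosSemidef) (htr : ∀ X, (T X).trace = X.trace)
    (h₁ : ∀ X, marg₁ (T X) = M X) (h₂ : ∀ X, marg₂ (T X) = M X)
    {ε : ℝ} (hε : ε < 1 / 100)
    (hF : ∀ σ : Op (Fin m × Fin m), IsState σ → 1 - ε ≤ fidelity σ (ampl (Fin m) M σ)) :
    False := by
  let i : Fin m := ⟨0, by omega⟩
  let j : Fin m := ⟨1, by omega⟩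
  have hij : i ≠ j := by simp [i, j]
  let v : ℝ → ℝ → Fin m → ℂ := fun α β => Pi.single i (α : ℂ) + Pi.single j (β : ℂ)
  have hv : ∀ α β γ δ : ℝ, star (v α β) ⬝ᵥ v γ δ = ((α * γ + β * δ : ℝ) : ℂ) := by
    intro α β γ δ
    simp [v, dotProduct_add, hij, hij.symm]
  let P : ℝ → ℝ → Op (Fin m) := fun α β => Matrix.vecMulVec (v α β) (star (v α β))
  have hT : ∀ α β, (T (P α β)).PosSemidef := fun α β =>
    hpos _ (Matrix.posSemidef_vecMulVec_self_star _)
  have ht : ∀ α β : ℝ, α * α + β * β = 1 → (T (P α β)).trace = 1 := by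
    intro α β h
    rw [htr, (isState_pure (by rw [hv, h, Complex.ofReal_one])).2]
  have hM : ∀ α β : ℝ, α * α + β * β = 1 → 1 - ε ≤ expect (M (P α β)) (v α β) := by
    intro α β h
    have hMp : (M (P α β)).PosSemidef := h₁ (P α β) ▸ posSemidef_marg₁ (hT α β)
    have h1 : star (v α β) ⬝ᵥ v α β = 1 := by rw [hv, h, Complex.ofReal_one]
    have h2 := hF _ (isState_pure (star_localVec_dotProduct i h1))
    rwa [fidelity_pure (star_localVec_dotProduct i h1) _ (expect_nonneg hMp (v α β))] at h2
    rw [ampl_localVec]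
    exact expect_ofReal hMp _
  have hq : ∀ α β : ℝ, α * α + β * β = 1 →
      1 - 2 * ε ≤ expect (T (P α β)) (tensorSq (v α β)) := by
    intro α β h
    have h3 := expect_tensorSq_ge (hT α β) (v := v α β) (by rw [hv, h, Complex.ofReal_one])
    rw [h₁, h₂, ht α β h, Complex.one_re] at h3
    linarith [hM α β h]
  -- Two orthonormal bases of the same plane have the same sum of projections. The second is rotated
  -- by the rational angle 3/5, 4/5.
  have hsum : T (P 1 0) + T (P 0 1) = T (P (3 / 5) (4 / 5)) + T (P (4 / 5) (-(3 / 5))) := by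
    rw [← hadd, ← hadd]
    congr 1
    ext k l
    simp only [P, v, Matrix.add_apply, Matrix.vecMulVec_apply, Pi.add_apply, Pi.star_apply,
      Pi.single_apply]
    split_ifs <;> simp <;> norm_num
  let w := tensorSq (v (3 / 5) (4 / 5))
  have hw : star w ⬝ᵥ w = 1 := by
    rw [star_tensorSq_dotProduct, hv]; norm_num
  -- Overlaps of tensor squares are squared overlaps: (3/5)² here and (4/5)² below.
  have ha : expect (T (P 1 0)) w ≤ 5 / 4 * (9 / 25) ^ 2 + 5 * (2 * ε) := by
    have := expect_le_of_overlap (hT 1 0) (ht 1 0 (by norm_num)) (u := tensorSq (v 1 0)) (v := w)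
      (by rw [star_tensorSq_dotProduct, hv]; norm_num) hw (s := 9 / 25)
      (by rw [star_tensorSq_dotProduct, hv]; norm_num) (by norm_num)
    linarith [hq 1 0 (by norm_num)]
  have hb : expect (T (P 0 1)) w ≤ 5 / 4 * (16 / 25) ^ 2 + 5 * (2 * ε) := by
    have := expect_le_of_overlap (hT 0 1) (ht 0 1 (by norm_num)) (u := tensorSq (v 0 1)) (v := w)
      (by rw [star_tensorSq_dotProduct, hv]; norm_num) hw (s := 16 / 25)
      (by rw [star_tensorSq_dotProduct, hv]; norm_num) (by norm_num)
    linarith [hq 0 1 (by norm_num)]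
  have hc := congrArg (fun S => expect S w) hsum
  simp only [expect_add] at hc
  have hd := expect_nonneg (hT (4 / 5) (-(3 / 5))) w
  have he : 1 - 2 * ε ≤ expect (T (P (3 / 5) (4 / 5))) w := hq _ _ (by norm_num)
  -- Cloning of the rotated vector gives 1 - 2ε on one side; the other is at most (5/4)(337/625) +
  -- 20ε = 0.674 + 20ε. This is impossible for ε < 1/100.
  linarith

end Clone


/-! ### Symmetric extensions -/

section SymExt

variable {a b c o : Type*} [Fintype a] [Fintype b] [Fintype c] [Fintype o]

/-- `R` extends the map with Choi matrix `N : a ⊗ b → o` to two receivers, who hold one copy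
of `b` each: each of them sees the outcome of `N`. -/
structure IsSymExt [DecidableEq b] (N : Op (o × (a × b)))
    (R : Op ((o × o) × (a × (b × b)))) : Prop where
  posSemidef : R.PosSemidef
  fst : ∀ p q x x' y y' z z', ∑ k, R ((p, k), (x, (y, z))) ((q, k), (x', (y', z'))) =
    N (p, (x, y)) (q, (x', y')) * if z = z' then 1 else 0
  snd : ∀ p q x x' y y' z z', ∑ k, R ((k, p), (x, (z, y))) ((k, q), (x', (z', y'))) =
    N (p, (x, y)) (q, (x', y')) * if z = z' then 1 else 0

/-- The two receivers' joint output. -/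
def symOut (R : Op ((o × o) × (a × (b × b)))) (E : Op b) (Y : Op a) : Op (o × o) :=
  ofChoi R (Matrix.kroneckerMap (· * ·) Y (Matrix.kroneckerMap (· * ·) E E))

lemma posSemidef_symOut [DecidableEq b] {N : Op (o × (a × b))}
    {R : Op ((o × o) × (a × (b × b)))} (h : IsSymExt N R) {E : Op b} (hE : IsState E)
    {Y : Op a} (hY : Y.PosSemidef) : (symOut R E Y).PosSemidef :=
  posSemidef_ofChoi h.posSemidef (hY.kronecker (hE.1.kronecker hE.1))

/-- Bob's input `E` is a fixed state, so each receiver may hold an independent copy; the unused one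
is traced away and contributes `Tr E = 1`. -/
lemma marg₁_symOut [DecidableEq b] {N : Op (o × (a × b))}
    {R : Op ((o × o) × (a × (b × b)))} (h : IsSymExt N R) {E : Op b} (hE : IsState E)
    (Y : Op a) :
    marg₁ (symOut R E Y) = ofChoi N (Matrix.kroneckerMap (· * ·) Y E) := by
  ext p q
  simp only [marg₁, symOut, ofChoi, Matrix.of_apply]
  rw [Finset.sum_comm]
  simp_rw [Finset.sum_comm (s := (Finset.univ : Finset o)), ← Finset.sum_mul]
  have hE' : ∑ z, E z z = 1 := hE.2
  simp only [Fintype.sum_prod_type, h.fst, Matrix.kroneckerMap_apply]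
  refine Finset.sum_congr rfl fun x _ => Finset.sum_congr rfl fun y _ => ?_
  have e : ∀ z x' y', ∑ z', (N (p, x, y) (q, x', y') * if z = z' then 1 else 0) *
      (Y x x' * (E y y' * E z z')) = E z z * (N (p, x, y) (q, x', y') * (Y x x' * E y y')) := by
    intro z x' y'
    simp only [mul_ite, mul_one, mul_zero, ite_mul, zero_mul, Finset.sum_ite_eq,
      Finset.mem_univ, if_true]
    ring
  simp only [e, ← Finset.mul_sum, ← Finset.sum_mul, hE', one_mul]

lemma marg₂_symOut [DecidableEq b] {N : Op (o × (a × b))}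
    {R : Op ((o × o) × (a × (b × b)))} (h : IsSymExt N R) {E : Op b} (hE : IsState E)
    (Y : Op a) :
    marg₂ (symOut R E Y) = ofChoi N (Matrix.kroneckerMap (· * ·) Y E) := by
  ext p q
  simp only [marg₂, symOut, ofChoi, Matrix.of_apply]
  rw [Finset.sum_comm]
  simp_rw [Finset.sum_comm (s := (Finset.univ : Finset o)), ← Finset.sum_mul]
  have hE' : ∑ z, E z z = 1 := hE.2
  simp only [Fintype.sum_prod_type, h.snd, Matrix.kroneckerMap_apply]
  refine Finset.sum_congr rfl fun x _ => ?_
  have e : ∀ z y x', ∑ z', ∑ y', (N (p, x, y) (q, x', y') * if z = z' then 1 else 0) *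
      (Y x x' * (E z z' * E y y')) =
      E z z * ∑ y', (N (p, x, y) (q, x', y') * (Y x x' * E y y')) := by
    intro z y x'
    rw [Finset.sum_comm, Finset.mul_sum]
    refine Finset.sum_congr rfl fun y' _ => ?_
    simp only [mul_ite, mul_one, mul_zero, ite_mul, zero_mul, Finset.sum_ite_eq,
      Finset.mem_univ, if_true]
    ring
  simp only [e, ← Finset.mul_sum, ← Finset.sum_mul, hE', one_mul]

/-- The Choi matrix of `D ⊗ D`. -/
def choiSq (D : Op (c × o)) : Op ((c × c) × (o × o)) :=
  Matrix.of fun x y => D (x.1.1, x.2.1) (y.1.1, y.2.1) * D (x.1.2, x.2.2) (y.1.2, y.2.2)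

omit [Fintype c] [Fintype o] in
lemma posSemidef_choiSq {D : Op (c × o)} (hD : D.PosSemidef) : (choiSq D).PosSemidef :=
  posSemidef_mul_entries (hD.submatrix fun x : (c × c) × (o × o) => (x.1.1, x.2.1))
    (hD.submatrix fun x : (c × c) × (o × o) => (x.1.2, x.2.2))

/-- The second decoder preserves the trace, so discarding its output amounts to discarding its
input. -/
lemma marg₁_choiSq [DecidableEq o] {D : Op (c × o)} (hD : IsTP D) (Z : Op (o × o)) :
    marg₁ (ofChoi (choiSq D) Z) = ofChoi D (marg₁ Z) := by
  ext u v
  simp only [marg₁, ofChoi, choiSq, Matrix.of_apply]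
  rw [Finset.sum_comm]
  simp_rw [Finset.sum_comm (s := (Finset.univ : Finset c)), ← Finset.sum_mul,
    ← Finset.mul_sum, hD _ _]
  simp only [Fintype.sum_prod_type, mul_ite, mul_one, mul_zero, ite_mul, zero_mul,
    Finset.sum_ite_eq, Finset.mem_univ, if_true, Finset.mul_sum]
  exact Finset.sum_congr rfl fun _ _ => Finset.sum_comm

lemma marg₂_choiSq [DecidableEq o] {D : Op (c × o)} (hD : IsTP D) (Z : Op (o × o)) :
    marg₂ (ofChoi (choiSq D) Z) = ofChoi D (marg₂ Z) := by
  ext u v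
  simp only [marg₂, ofChoi, choiSq, Matrix.of_apply]
  rw [Finset.sum_comm]
  simp_rw [Finset.sum_comm (s := (Finset.univ : Finset c)), ← Finset.sum_mul, hD _ _]
  simp only [Fintype.sum_prod_type, ite_mul, zero_mul, one_mul,
    Finset.sum_ite_irrel, Finset.sum_const_zero,
    Finset.sum_ite_eq, Finset.mem_univ, if_true, Finset.mul_sum]
  rw [Finset.sum_comm]
  exact Finset.sum_congr rfl fun _ _ => Finset.sum_comm

end SymExt

/-! ### Tensor products over the copies -/

section Pi

variable {ι : Type*} [Fintype ι] [DecidableEq ι] {a b o : ι → Type*}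
  [∀ i, Fintype (a i)] [∀ i, Fintype (b i)] [∀ i, Fintype (o i)] [∀ i, DecidableEq (b i)]

/-- The Choi matrix of `⨂ i, N i`. -/
def piChoi (N : ∀ i, Op (o i × (a i × b i))) :
    Op ((∀ i, o i) × ((∀ i, a i) × (∀ i, b i))) :=
  Matrix.of fun p q => ∏ i, N i (p.1 i, (p.2.1 i, p.2.2 i)) (q.1 i, (q.2.1 i, q.2.2 i))

omit [∀ i, Fintype (a i)] [∀ i, Fintype (b i)] in
lemma IsTP.pi [∀ i, DecidableEq (a i)] {N : ∀ i, Op (o i × (a i × b i))} (h : ∀ i, IsTP (N i)) : IsTP (piChoi N) := by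
  rintro ⟨s, s'⟩ ⟨t, t'⟩
  simp only [piChoi, Matrix.of_apply]
  have e := Fintype.prod_sum fun i (p : o i) => N i (p, (s i, s' i)) (p, (t i, t' i))
  have hs : ∀ i, (if (s i, s' i) = (t i, t' i) then (1 : ℂ) else 0) =
      (if s i = t i then 1 else 0) * if s' i = t' i then 1 else 0 := fun i =>
    ite_prod_eq _ _ _ _
  simp only [h _ _ _, hs, Finset.prod_mul_distrib, prod_ite_eq] at e
  rw [← e, ite_prod_eq]

/-- Partial traces of a tensor product factor over the copies, by distributing the product over
sums. -/
lemma IsSymExt.pi {N : ∀ i, Op (o i × (a i × b i))}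
    {R : ∀ i, Op ((o i × o i) × (a i × (b i × b i)))} (h : ∀ i, IsSymExt (N i) (R i)) :
    IsSymExt (piChoi N) (Matrix.of fun x y : ((∀ i, o i) × (∀ i, o i)) ×
      ((∀ i, a i) × ((∀ i, b i) × (∀ i, b i))) =>
      ∏ i, R i ((x.1.1 i, x.1.2 i), (x.2.1 i, (x.2.2.1 i, x.2.2.2 i)))
        ((y.1.1 i, y.1.2 i), (y.2.1 i, (y.2.2.1 i, y.2.2.2 i)))) where
  posSemidef := posSemidef_prod_entries Finset.univ fun i _ =>
    (h i).posSemidef.submatrix fun x : ((∀ i, o i) × (∀ i, o i)) ×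
      ((∀ i, a i) × ((∀ i, b i) × (∀ i, b i))) =>
      ((x.1.1 i, x.1.2 i), (x.2.1 i, (x.2.2.1 i, x.2.2.2 i)))
  fst p q x x' y y' z z' := by
    have e := Fintype.prod_sum fun i (k : o i) =>
      R i ((p i, k), (x i, (y i, z i))) ((q i, k), (x' i, (y' i, z' i)))
    simp only [(h _).fst, Finset.prod_mul_distrib, prod_ite_eq] at e
    exact e.symm
  snd p q x x' y y' z z' := by
    have e := Fintype.prod_sum fun i (k : o i) =>
      R i ((k, p i), (x i, (z i, y i))) ((k, q i), (x' i, (z' i, y' i)))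
    simp only [(h _).snd, Finset.prod_mul_distrib, prod_ite_eq] at e
    exact e.symm

end Pi


/-! ### Normalization of processes -/

section Pairing

variable {X Y : Type*} [Fintype X] [Fintype Y]

/-- `Tr [Wᵀ (α ⊗ β)]`. -/
def pairing (W : Op (X × Y)) (α : Op X) (β : Op Y) : ℂ :=
  ∑ s, ∑ t, W s t * α s.1 t.1 * β s.2 t.2

lemma pairing_eq (W : Op (X × Y)) (α : Op X) (β : Op Y) :
    pairing W α β = ∑ b, ∑ b', (∑ a, ∑ a', W (a, b) (a', b') * α a a') * β b b' := by
  simp only [pairing, Fintype.sum_prod_type, Finset.sum_mul]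
  rw [Finset.sum_comm]
  refine Finset.sum_congr rfl fun b _ => ?_
  exact (sum_comm_three fun b' a a' => W (a, b) (a', b') * α a a' * β b b').symm

lemma pairing_one_one [DecidableEq X] [DecidableEq Y] (W : Op (X × Y)) :
    pairing W 1 1 = W.trace := by
  simp [pairing_eq, Matrix.one_apply, Matrix.trace, Fintype.sum_prod_type, Matrix.diag]
  rw [Finset.sum_comm]

lemma pairing_add (V W : Op (X × Y)) (α : Op X) (β : Op Y) :
    pairing (V + W) α β = pairing V α β + pairing W α β := by
  simp [pairing, add_mul, Finset.sum_add_distrib]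

lemma pairing_sub (V W : Op (X × Y)) (α : Op X) (β : Op Y) :
    pairing (V - W) α β = pairing V α β - pairing W α β := by
  simp [pairing, sub_mul, Finset.sum_sub_distrib]

end Pairing

section Processes

variable {AI AO BI BO : Type*}

lemma pairing_swapParties [Fintype AI] [Fintype AO] [Fintype BI] [Fintype BO]
    (W : Op ((AI × AO) × (BI × BO))) (α : Op (AI × AO)) (β : Op (BI × BO)) :
    pairing (swapParties W) β α = pairing W α β := by
  simp only [pairing]
  refine Fintype.sum_equiv (Equiv.prodComm _ _) _ _ fun s =>
    Fintype.sum_equiv (Equiv.prodComm _ _) _ _ fun t => ?_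
  simp only [swapParties, Matrix.submatrix_apply, Equiv.prodComm_apply, Prod.fst_swap,
    Prod.snd_swap]
  ring

variable [Fintype AI] [Fintype AO] [Fintype BI] [Fintype BO]
  [DecidableEq AI] [DecidableEq AO] [DecidableEq BI] [DecidableEq BO]

/-- `Tr_O α = x 1`, for an operator `α` on `I ⊗ O`. -/
def HasMarginal {I O : Type*} [Fintype O] [DecidableEq I] (α : Op (I × O)) (x : ℂ) : Prop :=
  ∀ i i', ∑ k, α (i, k) (i', k) = if i = i' then x else 0

lemma hasMarginal_one {I O : Type*} [Fintype O] [DecidableEq I] [DecidableEq O] :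
    HasMarginal (1 : Op (I × O)) (Fintype.card O) := by
  intro i i'
  by_cases h : i = i' <;> simp [Matrix.one_apply, h]

omit [DecidableEq BI] [DecidableEq BO] in
lemma pairing_replAO (W : Op ((AI × AO) × (BI × BO))) {α : Op (AI × AO)} {x : ℂ}
    (hα : HasMarginal α x) (β : Op (BI × BO)) :
    pairing (replAO W) α β = x / Fintype.card AO * pairing W 1 β := by
  simp only [pairing_eq, Finset.mul_sum, ← mul_assoc]
  refine Finset.sum_congr rfl fun b _ => Finset.sum_congr rfl fun b' _ => ?_
  congr 1
  simp only [replAO, Matrix.of_apply, Fintype.sum_prod_type, ite_mul, zero_mul,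
    Finset.sum_ite_eq, Finset.mem_univ, if_true, Matrix.one_apply, mul_ite, mul_one, mul_zero]
  refine Finset.sum_congr rfl fun i _ => ?_
  rw [Finset.sum_comm]
  simp only [← Finset.mul_sum, hα i]
  simp only [mul_ite, mul_zero, Finset.sum_ite_eq, Finset.mem_univ, if_true]
  ring

omit [DecidableEq AI] [DecidableEq AO] in
lemma pairing_replBO (W : Op ((AI × AO) × (BI × BO))) (α : Op (AI × AO)) {β : Op (BI × BO)}
    {y : ℂ} (hβ : HasMarginal β y) :
    pairing (replBO W) α β = y / Fintype.card BO * pairing W α 1 := by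
  rw [← pairing_swapParties, ← pairing_swapParties W]
  exact pairing_replAO (swapParties W) hβ α

omit [DecidableEq BI] [DecidableEq BO] in
lemma pairing_replAI_one [Nonempty AI] (W : Op ((AI × AO) × (BI × BO))) (β : Op (BI × BO)) :
    pairing (replAI W) 1 β = pairing W 1 β := by
  simp only [pairing_eq]
  refine Finset.sum_congr rfl fun b _ => Finset.sum_congr rfl fun b' _ => ?_
  congr 1
  have hd : (Fintype.card AI : ℂ) ≠ 0 := by exact_mod_cast Fintype.card_ne_zero
  simp only [replAI, Matrix.of_apply, Matrix.one_apply, mul_ite, mul_one, mul_zero,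
    Finset.sum_ite_eq, Finset.mem_univ, if_true, Fintype.sum_prod_type]
  simp only [Finset.sum_const, Finset.card_univ, nsmul_eq_mul, ← Finset.mul_sum]
  rw [← mul_assoc, mul_inv_cancel₀ hd, one_mul, Finset.sum_comm]

omit [DecidableEq AI] [DecidableEq AO] in
lemma pairing_replBI_one [Nonempty BI] (W : Op ((AI × AO) × (BI × BO))) (α : Op (AI × AO)) :
    pairing (replBI W) α 1 = pairing W α 1 := by
  rw [← pairing_swapParties, ← pairing_swapParties W]
  exact pairing_replAI_one (swapParties W) α

/-- Trace-and-replace on an output turns a local operation into a multiple of the identity. The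
three terms of `noLoops` thus involve `1` on at least one side, and the marginal conditions reduce
each of them to `Tr W`; they sum to xy + xy - xy. Arbitrary scalars are allowed because ancilla
blocks of a channel have marginal 0 or 1. -/
lemma IsProcess.pairing_eq [Nonempty AI] [Nonempty AO] [Nonempty BI] [Nonempty BO]
    {W : Op ((AI × AO) × (BI × BO))} (hW : IsProcess W) {α : Op (AI × AO)}
    {β : Op (BI × BO)} {x y : ℂ} (hα : HasMarginal α x) (hβ : HasMarginal β y) :
    pairing W α β = x * y := by
  have hA : (Fintype.card AO : ℂ) ≠ 0 := by exact_mod_cast Fintype.card_ne_zero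
  have hB : (Fintype.card BO : ℂ) ≠ 0 := by exact_mod_cast Fintype.card_ne_zero
  have h11 : pairing W 1 1 = Fintype.card AO * Fintype.card BO := by
    rw [pairing_one_one, hW.trace_eq]; push_cast; rfl
  have hA1 : ∀ β, pairing (replAI (replAO W)) 1 β = pairing W 1 β := fun β => by
    rw [pairing_replAI_one, pairing_replAO W hasMarginal_one, div_self hA, one_mul]
  have hB1 : ∀ α, pairing (replBI (replBO W)) α 1 = pairing W α 1 := fun α => by
    rw [pairing_replBI_one, pairing_replBO W _ hasMarginal_one, div_self hB, one_mul]
  have h1β : pairing W 1 β = y * Fintype.card AO := by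
    rw [← hA1, hW.margB, pairing_replBO _ _ hβ, hA1, h11]
    field_simp
  have hα1 : pairing W α 1 = x * Fintype.card BO := by
    rw [← hB1, hW.margA, pairing_replAO _ hα, hB1, h11]
    field_simp
  rw [hW.noLoops, pairing_sub, pairing_add, pairing_replAO _ hα, pairing_replBO _ _ hβ,
    pairing_replAO _ hα, pairing_replBO _ _ hβ, h1β, hα1, h11]
  field_simp
  ring

lemma IsProcess.swap {W : Op ((AI × AO) × (BI × BO))} (hW : IsProcess W) :
    IsProcess (swapParties W) where
  posSemidef := hW.posSemidef.submatrix _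
  trace_eq := by
    rw [← pairing_one_one, pairing_swapParties, pairing_one_one, hW.trace_eq, mul_comm]
  margA := congrArg swapParties hW.margB
  margB := congrArg swapParties hW.margA
  noLoops := by
    have hc : replBO (replAO W) = replAO (replBO W) := by
      ext ⟨⟨i, k⟩, ⟨j, l⟩⟩ ⟨⟨i', k'⟩, ⟨j', l'⟩⟩
      simp only [replAO, replBO, Matrix.of_apply]
      by_cases h1 : k = k' <;> by_cases h2 : l = l' <;> simp [h1, h2, Finset.mul_sum]
      rw [Finset.sum_comm]
      simp only [mul_left_comm]
    have h := hW.noLoops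
    rw [← hc, add_comm] at h
    exact congrArg swapParties h

/-! ### Channels induced by a process -/

section Induced

variable {AI' AO' BI' BO' : Type*}

omit [DecidableEq AI] [DecidableEq AO] [DecidableEq BI] [DecidableEq BO] in
lemma induced_add (V W : Op ((AI × AO) × (BI × BO)))
    (A : Op ((AO × AO') × (AI × AI'))) (B : Op ((BO × BO') × (BI × BI'))) :
    induced (V + W) A B = induced V A B + induced W A B := by
  ext p q
  simp [induced, add_mul, Finset.sum_add_distrib]

omit [DecidableEq AI] [DecidableEq AO] [DecidableEq BI] [DecidableEq BO] in
lemma induced_smul (c : ℂ) (W : Op ((AI × AO) × (BI × BO)))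
    (A : Op ((AO × AO') × (AI × AI'))) (B : Op ((BO × BO') × (BI × BI'))) :
    induced (c • W) A B = c • induced W A B := by
  ext p q
  simp [induced, Finset.mul_sum, mul_assoc]

omit [DecidableEq AI] [DecidableEq AO] [DecidableEq BI] [DecidableEq BO] in
lemma induced_swapParties (W : Op ((AI × AO) × (BI × BO)))
    (A : Op ((AO × AO') × (AI × AI'))) (B : Op ((BO × BO') × (BI × BI'))) (p q) :
    induced (swapParties W) B A p q = induced W A B (p.1.swap, p.2.swap) (q.1.swap, q.2.swap) := by
  simp only [induced, Matrix.of_apply]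
  refine Fintype.sum_equiv (Equiv.prodComm _ _) _ _ fun s =>
    Fintype.sum_equiv (Equiv.prodComm _ _) _ _ fun t => ?_
  simp only [swapParties, Matrix.submatrix_apply, Equiv.prodComm_apply, Prod.fst_swap,
    Prod.snd_swap]
  ring

omit [DecidableEq AI] [DecidableEq AO] [DecidableEq BI] [DecidableEq BO] in
lemma posSemidef_induced [Finite AI'] [Finite AO'] [Finite BI'] [Finite BO']
    {W : Op ((AI × AO) × (BI × BO))} (hW : W.PosSemidef)
    {A : Op ((AO × AO') × (AI × AI'))} (hA : A.PosSemidef)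
    {B : Op ((BO × BO') × (BI × BI'))} (hB : B.PosSemidef) :
    (induced W A B).PosSemidef := by
  let Z := ((AO' × BO') × (AI' × BI')) × ((AI × AO) × (BI × BO))
  let f : Z → (AO × AO') × (AI × AI') := fun x => ((x.2.1.2, x.1.1.1), (x.2.1.1, x.1.2.1))
  let g : Z → (BO × BO') × (BI × BI') := fun x => ((x.2.2.2, x.1.1.2), (x.2.2.1, x.1.2.2))
  exact posSemidef_collapse (H := Matrix.of fun x y : Z =>
      W x.2 y.2 * A (f x) (f y) * B (g x) (g y))
    (posSemidef_mul_entries (posSemidef_mul_entries (hW.submatrix Prod.snd) (hA.submatrix f))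
      (hB.submatrix g))

/-- For fixed ancilla indices, tracing the outgoing ancillas leaves local operators with marginals
`δ_{aa'}` and `δ_{bb'}`, to which the normalization of `W` applies. -/
lemma isTP_induced [Nonempty AI] [Nonempty AO] [Nonempty BI] [Nonempty BO]
    [Fintype AO'] [Fintype BO'] [DecidableEq AI'] [DecidableEq BI']
    {W : Op ((AI × AO) × (BI × BO))} (hW : IsProcess W)
    {A : Op ((AO × AO') × (AI × AI'))} (hA : IsTP A)
    {B : Op ((BO × BO') × (BI × BI'))} (hB : IsTP B) :
    IsTP (induced W A B) := by
  rintro ⟨a, b⟩ ⟨a', b'⟩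
  have hα : HasMarginal (Matrix.of fun s t : AI × AO =>
      ∑ p, A ((s.2, p), (s.1, a)) ((t.2, p), (t.1, a'))) (if a = a' then 1 else 0) := by
    intro i i'
    have := hA (i, a) (i', a')
    rw [Fintype.sum_prod_type] at this
    simpa [ite_and] using this
  have hβ : HasMarginal (Matrix.of fun s t : BI × BO =>
      ∑ p, B ((s.2, p), (s.1, b)) ((t.2, p), (t.1, b'))) (if b = b' then 1 else 0) := by
    intro i i'
    have := hB (i, b) (i', b')
    rw [Fintype.sum_prod_type] at this
    simpa [ite_and] using this
  have h := hW.pairing_eq hα hβ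
  rw [ite_prod_eq, ← h, pairing]
  simp only [induced, Matrix.of_apply, mul_assoc, Finset.sum_mul_sum]
  rw [sum_comm_three]
  simp only [← Finset.mul_sum, Fintype.sum_prod_type (α₁ := AO') (α₂ := BO')]

end Induced

/-! ### Processes without signalling from Alice to Bob -/

/-- Polarization: basis states give the diagonal, and the superpositions of `e_a` and `z e_{a'}`
with z = 1 and z = i give the off-diagonal entries. -/
lemma eq_ite_of_const_on_states {d : Type*} [Fintype d] [DecidableEq d] {F : d → d → ℂ} {c : ℂ}
    (h : ∀ ρ : Op d, IsState ρ → ∑ a, ∑ a', ρ a a' * F a a' = c) (a a' : d) :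
    F a a' = if a = a' then c else 0 := by
  have hd : ∀ a, F a a = c := by
    intro a
    have := h (Matrix.vecMulVec (Pi.single a 1) (star (Pi.single a 1)))
      (isState_pure (by simp))
    simpa [Matrix.vecMulVec_apply, Pi.single_apply] using this
  by_cases haa : a = a'
  · subst haa; simp [hd]
  rw [if_neg haa]
  have hz : ∀ z : ℂ, z * star z = 1 → star z * F a a' + z * F a' a = 0 := by
    intro z hz
    let v : d → ℂ := Pi.single a 1 + Pi.single a' z
    have hs : IsState ((1 / 2 : ℂ) • Matrix.vecMulVec v (star v)) := by
      refine ⟨(Matrix.posSemidef_vecMulVec_self_star v).smul (by rw [Complex.le_def]; norm_num), ?_⟩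
      rw [Matrix.trace_smul, Matrix.trace_vecMulVec]
      simp [v, haa, Ne.symm haa]
      simp at hz
      rw [hz]; norm_num
    have key := h _ hs
    simp [v, Matrix.vecMulVec_apply, Pi.single_apply, add_mul, mul_add, Finset.sum_add_distrib,
      hd] at key
    rw [Complex.star_def] at hz ⊢
    linear_combination 2 * key - c * hz
  have h1 := hz 1 (by simp)
  have h2 := hz Complex.I (by simp)
  simp at h1 h2
  have h3 : Complex.I * (F a' a - F a a') = 0 := by linear_combination h2
  have h4 : F a' a - F a a' = 0 := (mul_eq_zero.mp h3).resolve_left Complex.I_ne_zero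
  linear_combination h1 / 2 - h4 / 2

end Processes


section Processes

variable {AI AO BI BO : Type*} [Fintype AI] [Fintype AO] [Fintype BI] [Fintype BO]
  [DecidableEq AI] [DecidableEq AO] [DecidableEq BI] [DecidableEq BO]

/-- The Choi matrix of `A(· ⊗ ρ)`, for a state `ρ` of the incoming ancilla. -/
def plugState {d : Type*} [Fintype d] (ρ : Op d) (A : Op ((AO × Unit) × (AI × d))) :
    Op ((AO × Unit) × (AI × Unit)) :=
  Matrix.of fun x y => ∑ a, ∑ a', A (x.1, (x.2.1, a)) (y.1, (y.2.1, a')) * ρ a a'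

omit [DecidableEq AI] [DecidableEq AO] in
lemma posSemidef_plugState {d : Type*} [Fintype d] {ρ : Op d} (hρ : ρ.PosSemidef)
    {A : Op ((AO × Unit) × (AI × d))} (hA : A.PosSemidef) : (plugState ρ A).PosSemidef := by
  let f : ((AO × Unit) × (AI × Unit)) × d → (AO × Unit) × (AI × d) :=
    fun x => (x.1.1, (x.1.2.1, x.2))
  exact posSemidef_collapse (H := Matrix.of fun x y => A (f x) (f y) * ρ x.2 y.2)
    (posSemidef_mul_entries (hA.submatrix f) (hρ.submatrix Prod.snd))

omit [Fintype AI] [DecidableEq AO] in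
lemma isTP_plugState {d : Type*} [Fintype d] [DecidableEq d] {ρ : Op d} (hρ : ρ.trace = 1)
    {A : Op ((AO × Unit) × (AI × d))} (hA : IsTP A) : IsTP (plugState ρ A) := by
  rintro ⟨s, ⟨⟩⟩ ⟨t, ⟨⟩⟩
  have hρ' : ∑ a, ρ a a = 1 := hρ
  simp only [plugState, Matrix.of_apply]
  rw [sum_comm_three]
  simp only [← Finset.sum_mul, hA _ _, ite_prod_eq]
  simp [hρ']

omit [DecidableEq AI] [DecidableEq AO] [DecidableEq BI] [DecidableEq BO] in
lemma induced_plugState {d BI' BO' : Type*} [Fintype d] (W : Op ((AI × AO) × (BI × BO)))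
    (ρ : Op d) (A : Op ((AO × Unit) × (AI × d))) (B : Op ((BO × BO') × (BI × BI'))) (p q b b') :
    induced W (plugState ρ A) B (((), p), ((), b)) (((), q), ((), b')) =
      ∑ a, ∑ a', ρ a a' * induced W A B (((), p), (a, b)) (((), q), (a', b')) := by
  simp only [induced, plugState, Matrix.of_apply, Finset.mul_sum, Finset.sum_mul]
  refine Eq.trans (Finset.sum_congr rfl fun s _ => ?_) (sum_comm_three _)
  refine Eq.trans ?_ (sum_comm_three _)
  refine Finset.sum_congr rfl fun t _ => Finset.sum_congr rfl fun a _ =>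
    Finset.sum_congr rfl fun a' _ => ?_
  ring

omit [DecidableEq AO] [DecidableEq BO] in
/-- Without signalling from Alice to Bob, the induced channel ignores Alice's ancilla. -/
lemma induced_eq_ite_of_noSignalling {W : Op ((AI × AO) × (BI × BO))}
    (hW : NoSignallingBobToAlice (swapParties W)) {d k l : ℕ}
    {A : Op (AI × Fin d) →ₗ[ℂ] Op (AO × Unit)} {B : Op (BI × Fin k) →ₗ[ℂ] Op (BO × Fin l)}
    (hA : IsChannel A) (hB : IsChannel B) (a₀ a a' : Fin d) (p q : Fin l) (b b' : Fin k) :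
    induced W (choi A) (choi B) (((), p), (a, b)) (((), q), (a', b')) =
      if a = a' then induced W (choi A) (choi B) (((), p), (a₀, b)) (((), q), (a₀, b'))
      else 0 := by
  have key : ∀ ρ σ : Op (Fin d), IsState ρ → IsState σ →
      induced W (plugState ρ (choi A)) (choi B) (((), p), ((), b)) (((), q), ((), b')) =
      induced W (plugState σ (choi A)) (choi B) (((), p), ((), b)) (((), q), ((), b')) := by
    intro ρ σ hρ hσ
    -- In the swapped process Bob is the party with ancillas, and plugging ρ or σ into `A` gives two
    -- ancilla-free channels for Alice, which Bob cannot tell apart.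
    have h := hW k l B (ofChoiₗ (plugState ρ (choi A))) (ofChoiₗ (plugState σ (choi A))) hB
      (isChannel_ofChoiₗ (posSemidef_plugState hρ.1 hA.posSemidef_choi)
        (isTP_plugState hρ.2 hA.isTP_choi))
      (isChannel_ofChoiₗ (posSemidef_plugState hσ.1 hA.posSemidef_choi)
        (isTP_plugState hσ.2 hA.isTP_choi))
    rw [choi_ofChoiₗ, choi_ofChoiₗ] at h
    have h2 := congrFun (congrFun h ((p, ()), (b, ()))) ((q, ()), (b', ()))
    rwa [induced_swapParties, induced_swapParties] at h2
  have h₀ : IsState (Matrix.vecMulVec (Pi.single a₀ 1) (star (Pi.single a₀ (1 : ℂ)))) :=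
    isState_pure (by simp)
  refine eq_ite_of_const_on_states (F := fun a a' =>
    induced W (choi A) (choi B) (((), p), (a, b)) (((), q), (a', b'))) (fun ρ hρ => ?_) a a'
  have h := key ρ _ hρ h₀
  rw [induced_plugState, induced_plugState] at h
  rw [h]
  simp [Matrix.vecMulVec_apply, Pi.single_apply]

/-! ### Protocols -/

/-- An equal mixture with a channel that ignores Alice's ancilla is symmetrically extendible. -/
lemma isSymExt_mixture {a b o : Type*} [Fintype a] [Fintype b] [Fintype o] [DecidableEq a]
    [DecidableEq b] {N₁ N₂ : Op (o × (a × b))} {K : Op (o × b)} (h₁ : N₁.PosSemidef)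
    (hK : K.PosSemidef) (t₁ : IsTP N₁) (tK : IsTP K)
    (h₂ : ∀ p q x x' y y', N₂ (p, (x, y)) (q, (x', y')) = if x = x' then K (p, y) (q, y') else 0) :
    IsSymExt ((1 / 2 : ℂ) • N₁ + (1 / 2 : ℂ) • N₂)
      ((1 / 2 : ℂ) • (Matrix.of (fun s t =>
          N₁ (s.1.1, (s.2.1, s.2.2.1)) (t.1.1, (t.2.1, t.2.2.1)) *
          K (s.1.2, s.2.2.2) (t.1.2, t.2.2.2)) +
        Matrix.of (fun s t =>
          N₁ (s.1.2, (s.2.1, s.2.2.2)) (t.1.2, (t.2.1, t.2.2.2)) *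
          K (s.1.1, s.2.2.1) (t.1.1, t.2.2.1)) : Op ((o × o) × (a × (b × b))))) where
  posSemidef := by
    have e₁ := posSemidef_mul_entries
      (h₁.submatrix fun s : (o × o) × (a × (b × b)) => (s.1.1, (s.2.1, s.2.2.1)))
      (hK.submatrix fun s : (o × o) × (a × (b × b)) => (s.1.2, s.2.2.2))
    have e₂ := posSemidef_mul_entries
      (h₁.submatrix fun s : (o × o) × (a × (b × b)) => (s.1.2, (s.2.1, s.2.2.2)))
      (hK.submatrix fun s : (o × o) × (a × (b × b)) => (s.1.1, s.2.2.1))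
    exact (e₁.add e₂).smul (by rw [Complex.le_def]; norm_num)
  -- In the first term `K` is traced out, leaving ½N₁. In the second N₁ is traced out, leaving
  -- ½`δ_{xx'}`K, which is ½N₂.
  fst p q x x' y y' z z' := by
    simp only [Matrix.smul_apply, Matrix.add_apply, Matrix.of_apply, smul_eq_mul,
      ← Finset.mul_sum, Finset.sum_add_distrib, ← Finset.sum_mul, tK z z', h₂,
      t₁ (x, z) (x', z'), ite_prod_eq]
    by_cases hx : x = x'
    · simp only [hx, if_true]; split_ifs <;> ring
    · simp [hx]
  snd p q x x' y y' z z' := by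
    simp only [Matrix.smul_apply, Matrix.add_apply, Matrix.of_apply, smul_eq_mul,
      ← Finset.mul_sum, Finset.sum_add_distrib, ← Finset.sum_mul, tK z z', h₂,
      t₁ (x, z) (x', z'), ite_prod_eq]
    by_cases hx : x = x'
    · simp only [hx, if_true]; split_ifs <;> ring
    · simp [hx]

/-- Drop the trivial ancilla of Alice's output. -/
def dropUnit {o x : Type*} (N : Op ((Unit × o) × x)) : Op (o × x) :=
  N.submatrix (fun y => (((), y.1), y.2)) (fun y => (((), y.1), y.2))

lemma IsTP.dropUnit {o x : Type*} [Fintype o] [DecidableEq x] {N : Op ((Unit × o) × x)}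
    (h : IsTP N) : IsTP (dropUnit N) := by
  intro s t
  rw [← h s t, Fintype.sum_prod_type]
  simp [CausalComm.dropUnit]

namespace Protocol

variable {n m : ℕ}

omit [DecidableEq AO] [DecidableEq BO] in
lemma channel_eq (P : Protocol AI AO BI BO n m) (W : Op ((AI × AO) × (BI × BO)))
    (X : Op (Fin m)) : P.channel W X = ofChoi (choi P.DB)
      (ofChoi (piChoi fun i => dropUnit (induced W (choi (P.A i)) (choi (P.B i))))
        (Matrix.kroneckerMap (· * ·) (P.EA X) P.EB)) := by
  rw [ofChoi_choi]; rfl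

lemma trace_channel [Nonempty AI] [Nonempty AO] [Nonempty BI] [Nonempty BO]
    (P : Protocol AI AO BI BO n m) {W₁ W₂ : Op ((AI × AO) × (BI × BO))} (h₁ : IsProcess W₁)
    (h₂ : IsProcess W₂) (X : Op (Fin m)) :
    (P.channel ((1 / 2 : ℂ) • W₁ + (1 / 2 : ℂ) • W₂) X).trace = X.trace := by
  have hT : ∀ i, IsTP (dropUnit (induced ((1 / 2 : ℂ) • W₁ + (1 / 2 : ℂ) • W₂)
      (choi (P.A i)) (choi (P.B i)))) := by
    intro i
    refine IsTP.dropUnit fun s t => ?_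
    have t₁ := isTP_induced h₁ (P.A_channel i).isTP_choi (P.B_channel i).isTP_choi s t
    have t₂ := isTP_induced h₂ (P.A_channel i).isTP_choi (P.B_channel i).isTP_choi s t
    rw [induced_add, induced_smul, induced_smul]
    simp only [Matrix.add_apply, Matrix.smul_apply, smul_eq_mul, Finset.sum_add_distrib,
      ← Finset.mul_sum, t₁, t₂]
    ring
  rw [channel_eq, trace_ofChoi P.DB_channel.isTP_choi, trace_ofChoi (IsTP.pi hT)]
  have := Matrix.trace_kronecker (P.EA X) P.EB
  rw [P.EB_state.2, mul_one, P.EA_channel.tracePreserving] at this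
  exact this

theorem not_reliable [Nonempty AI] [Nonempty AO] [Nonempty BI] [Nonempty BO]
    (P : Protocol AI AO BI BO n m) {W₁ W₂ : Op ((AI × AO) × (BI × BO))} (h₁ : IsProcess W₁)
    (h₂ : IsProcess W₂) (hns : NoSignallingBobToAlice (swapParties W₂)) (hm : 2 ≤ m)
    {ε : ℝ} (hε : ε < 1 / 100)
    (hF : ∀ σ : Op (Fin m × Fin m), IsState σ →
      1 - ε ≤ fidelity σ (ampl (Fin m) (P.channel ((1 / 2 : ℂ) • W₁ + (1 / 2 : ℂ) • W₂)) σ)) :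
    False := by
  -- Ancillas of dimension 0 are formally allowed, but no trace-preserving encoder can map into
  -- them. A basis index `a₀` is needed to define `K`.
  have hne : Nonempty (∀ i, Fin (P.dimA i)) := by
    by_contra hne
    rw [not_nonempty_iff] at hne
    have h0 : (P.EA 1).trace = 0 := by simp [Matrix.trace]
    rw [P.EA_channel.tracePreserving, Matrix.trace_one, Fintype.card_fin] at h0
    have : m = 0 := by exact_mod_cast h0
    omega
  obtain ⟨a₀⟩ := hne
  have hS : ∀ i, ∃ R, IsSymExt (dropUnit (induced ((1 / 2 : ℂ) • W₁ + (1 / 2 : ℂ) • W₂)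
      (choi (P.A i)) (choi (P.B i)))) R := by
    intro i
    have hA := P.A_channel i
    have hB := P.B_channel i
    have t₂ := (isTP_induced h₂ hA.isTP_choi hB.isTP_choi).dropUnit
    have p₁ := posSemidef_induced h₁.posSemidef hA.posSemidef_choi hB.posSemidef_choi
    have p₂ := posSemidef_induced h₂.posSemidef hA.posSemidef_choi hB.posSemidef_choi
    rw [induced_add, induced_smul, induced_smul]
    refine ⟨_, isSymExt_mixture (N₁ := dropUnit (induced W₁ (choi (P.A i)) (choi (P.B i))))
      (N₂ := dropUnit (induced W₂ (choi (P.A i)) (choi (P.B i))))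
      (K := (dropUnit (induced W₂ (choi (P.A i)) (choi (P.B i)))).submatrix
        (fun y => (y.1, (a₀ i, y.2))) (fun y => (y.1, (a₀ i, y.2))))
      (p₁.submatrix _) ((p₂.submatrix _).submatrix _)
      (isTP_induced h₁ hA.isTP_choi hB.isTP_choi).dropUnit ?_ ?_⟩
    · intro s t
      have := t₂ (a₀ i, s) (a₀ i, t)
      simpa using this
    · intro p q x x' y y'
      exact induced_eq_ite_of_noSignalling hns hA hB (a₀ i) x x' p q y y'
  choose R hR using hS
  have hpi := IsSymExt.pi hR
  set Q := Matrix.of fun x y : ((∀ i, Fin (P.dimB' i)) × (∀ i, Fin (P.dimB' i))) ×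
      ((∀ i, Fin (P.dimA i)) × ((∀ i, Fin (P.dimB i)) × (∀ i, Fin (P.dimB i)))) =>
      ∏ i, R i ((x.1.1 i, x.1.2 i), (x.2.1 i, (x.2.2.1 i, x.2.2.2 i)))
        ((y.1.1 i, y.1.2 i), (y.2.1 i, (y.2.2.1 i, y.2.2.2 i)))
  have hD := P.DB_channel
  have m₁ : ∀ X, marg₁ (ofChoi (choiSq (choi P.DB)) (symOut Q P.EB (P.EA X))) =
      P.channel ((1 / 2 : ℂ) • W₁ + (1 / 2 : ℂ) • W₂) X := fun X => by
    rw [marg₁_choiSq hD.isTP_choi, marg₁_symOut hpi P.EB_state, channel_eq]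
  have m₂ : ∀ X, marg₂ (ofChoi (choiSq (choi P.DB)) (symOut Q P.EB (P.EA X))) =
      P.channel ((1 / 2 : ℂ) • W₁ + (1 / 2 : ℂ) • W₂) X := fun X => by
    rw [marg₂_choiSq hD.isTP_choi, marg₂_symOut hpi P.EB_state, channel_eq]
  refine false_of_symmetric_extension hm (fun X Y => ?_) (fun X hX => ?_) (fun X => ?_)
    m₁ m₂ hε hF
  · have e : symOut Q P.EB (P.EA (X + Y)) = symOut Q P.EB (P.EA X) + symOut Q P.EB (P.EA Y) := by
      rw [map_add, symOut, Matrix.add_kronecker]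
      exact map_add (ofChoiₗ Q) _ _
    rw [e]
    exact map_add (ofChoiₗ (choiSq (choi P.DB))) _ _
  · exact posSemidef_ofChoi (posSemidef_choiSq hD.posSemidef_choi)
      (posSemidef_symOut hpi P.EB_state (P.EA_channel.posSemidef hX))
  -- The trace of the joint output equals that of its marginal `M X`.
  · rw [← trace_channel P h₁ h₂ X, ← m₁]
    simp [Matrix.trace, marg₁, Fintype.sum_prod_type]

end Protocol

/-! ### The trivial code -/

/-- The Choi matrix of the channel that prepares `ρ`. -/
def prepare (a : Type*) {b : Type*} [DecidableEq a] (ρ : Op b) : Op (b × a) :=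
  Matrix.of fun x y => ρ x.1 y.1 * (1 : Op a) x.2 y.2

lemma isChannel_prepare (a : Type*) {b : Type*} [Fintype a] [Fintype b] [DecidableEq a]
    {ρ : Op b} (hρ : IsState ρ) : IsChannel (ofChoiₗ (prepare a ρ)) := by
  refine isChannel_ofChoiₗ (posSemidef_mul_entries (hρ.1.submatrix Prod.fst)
    (Matrix.PosSemidef.one.submatrix Prod.snd)) fun s t => ?_
  have h : ∑ p, ρ p p = 1 := hρ.2
  calc ∑ p, ρ p p * (1 : Op a) s t = (∑ p, ρ p p) * (1 : Op a) s t :=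
        (Finset.sum_mul _ _ _).symm
    _ = _ := by rw [h, one_mul, Matrix.one_apply]

lemma exists_state (a : Type*) [Fintype a] [Nonempty a] : ∃ ρ : Op a, IsState ρ := by
  classical
  obtain ⟨i⟩ := ‹Nonempty a›
  exact ⟨_, isState_pure (ψ := Pi.single i 1) (by simp)⟩

lemma exists_channel (a b : Type*) [Fintype a] [Fintype b] [Nonempty b] :
    ∃ Φ : Op a →ₗ[ℂ] Op b, IsChannel Φ := by
  classical
  obtain ⟨ρ, hρ⟩ := exists_state b
  exact ⟨_, isChannel_prepare a hρ⟩

variable (AI AO BI BO) in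
omit [DecidableEq AI] [DecidableEq AO] [DecidableEq BI] [DecidableEq BO] in
lemma nonempty_protocol [Nonempty AO] [Nonempty BO] (n : ℕ) :
    Nonempty (Protocol AI AO BI BO n 1) := by
  obtain ⟨A, hA⟩ := exists_channel (AI × Fin 1) (AO × Unit)
  obtain ⟨B, hB⟩ := exists_channel (BI × Fin 1) (BO × Fin 1)
  obtain ⟨EA, hEA⟩ := exists_channel (Fin 1) (Fin n → Fin 1)
  obtain ⟨EB, hEB⟩ := exists_state (Fin n → Fin 1)
  obtain ⟨DB, hDB⟩ := exists_channel (Fin n → Fin 1) (Fin 1)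
  exact ⟨⟨fun _ => 1, fun _ => 1, fun _ => 1, fun _ => A, fun _ => B, EA, EB, DB,
    fun _ => hA, fun _ => hB, hEA, hEB, hDB⟩⟩

/-- In dimension one the only trace-one operator is 1. These codes make rate 0 achievable, so the
supremum in `EReal` is not the `⊥` of an empty set. -/
lemma hasCode_zero [Nonempty AI] [Nonempty AO] [Nonempty BI] [Nonempty BO]
    {W₁ W₂ : Op ((AI × AO) × (BI × BO))} (h₁ : IsProcess W₁) (h₂ : IsProcess W₂) (n : ℕ) :
    HasCode ((1 / 2 : ℂ) • W₁ + (1 / 2 : ℂ) • W₂) 0 n 0 := by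
  obtain ⟨P⟩ := nonempty_protocol AI AO BI BO n
  refine ⟨1, one_pos, by simp, P, fun σ hσ => ?_⟩
  have e : ∀ X : Op (Fin 1 × Fin 1), X.trace = 1 → X = 1 := by
    intro X hX
    ext i j
    rw [Subsingleton.elim i (0, 0), Subsingleton.elim j (0, 0)]
    simpa [Matrix.trace, Fintype.sum_prod_type] using hX
  have hσ1 := e σ hσ.2
  have h := P.trace_channel h₁ h₂ (1 : Op (Fin 1))
  have hρ : ampl (Fin 1) (P.channel ((1 / 2 : ℂ) • W₁ + (1 / 2 : ℂ) • W₂)) σ = 1 := by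
    refine e _ ?_
    have e1 : (Matrix.of fun s t : Fin 1 => (1 : Op (Fin 1 × Fin 1)) (0, s) (0, t)) = 1 := by
      ext s t
      simp [Matrix.one_apply]
    rw [hσ1]
    simp only [Matrix.trace, Matrix.diag, ampl, Fintype.sum_prod_type, Matrix.of_apply,
      Fin.sum_univ_one] at h ⊢
    rw [e1, h]
    simp
  rw [hρ, hσ1, fidelity]
  simp [Matrix.trace_one]

lemma capacityAliceToBob_eq_zero [Nonempty AI] [Nonempty AO] [Nonempty BI] [Nonempty BO]
    {W₁ W₂ : Op ((AI × AO) × (BI × BO))} (h₁ : IsProcess W₁) (h₂ : IsProcess W₂)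
    (hns : NoSignallingBobToAlice (swapParties W₂)) :
    capacityAliceToBob ((1 / 2 : ℂ) • W₁ + (1 / 2 : ℂ) • W₂) = 0 := by
  refine le_antisymm (sSup_le ?_) (le_sSup ?_)
  · rintro _ ⟨R, ⟨r, ε, hr, hε, hcode⟩, rfl⟩
    have hev : ∀ᶠ n in Filter.atTop, r n = 0 := by
      filter_upwards [hε.eventually (gt_mem_nhds (show (0 : ℝ) < 1 / 100 by norm_num)),
        Filter.eventually_gt_atTop 0] with n hn hn0
      obtain ⟨m, hm, hR, P, hP⟩ := hcode n hn0
      have hm1 : m = 1 := by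
        by_contra hne
        exact P.not_reliable h₁ h₂ hns (by omega) hn hP
      rw [hR, hm1]
      simp
    have : R = 0 := tendsto_nhds_unique hr (tendsto_const_nhds.congr'
      (hev.mono fun n hn => hn.symm))
    simp [this]
  · exact ⟨0, ⟨fun _ => 0, fun _ => 0, tendsto_const_nhds, tendsto_const_nhds,
      fun n _ => hasCode_zero h₁ h₂ n⟩, by simp⟩

end Processes

end CausalComm

end

theorem corollary2 {AI AO BI BO : Type*}
    [Fintype AI] [Fintype AO] [Fintype BI] [Fintype BO]
    [DecidableEq AI] [DecidableEq AO] [DecidableEq BI] [DecidableEq BO]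
    [Nonempty AI] [Nonempty AO] [Nonempty BI] [Nonempty BO]
    (W₁ W₂ : Matrix ((AI × AO) × (BI × BO)) ((AI × AO) × (BI × BO)) ℂ)
    (hW₁ : CausalComm.IsProcessAliceFirst W₁)
    (hW₂ : CausalComm.IsProcessBobFirst W₂) :
    CausalComm.capacityAliceToBob ((1 / 2 : ℂ) • W₁ + (1 / 2 : ℂ) • W₂) = 0 ∧
    CausalComm.capacityBobToAlice ((1 / 2 : ℂ) • W₁ + (1 / 2 : ℂ) • W₂) = 0 := by
  refine ⟨CausalComm.capacityAliceToBob_eq_zero hW₁.1 hW₂.1 hW₂.2, ?_⟩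
  -- After exchanging the parties, W₁ is the component that ignores the sender, so it takes the
  -- second place.
  rw [add_comm]
  exact CausalComm.capacityAliceToBob_eq_zero hW₂.1.swap hW₁.1.swap hW₁.2
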